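/- **Setting.** Let $n\in\mathbb N$ and equip $\mathbb R^n$ and $(0,\infty)$ with Lebesgue measure. For a measurable $f$ with values in $[-\infty,\infty]$ let $f^*(t)=\inf\{\lambda\in(0,\infty):|\{|f|>\lambda\}|\le t\}$ and $f^{**}(t)=\frac1t\int_0^t f^*(s)\,ds$ for $t\in(0,\infty)$. A rearrangement-invariant space $X$ over $\mathbb R^n$ is the set of measurable $f$ with $\|f\|_X:=\varrho(|f|)<\infty$, where $\varrho$ is a rearrangement-invariant Banach function norm, that is, a functional with values in $[0,\infty]$ on the nonnegative measurable functions which is a norm (up to equality a.e.), is monotone, has the Fatou property ($f_j\nearrow f$ a.e. implies $\varrho(f_j)\nearrow\varrho(f)$), is finite on characteristic functions of sets $E$ of finite measure, satisfies $\int_E f\le C_E\,\varrho(f)$ for all such $E$, and satisfies $\varrho(f)=\varrho(g)$ whenever $f^*=g^*$. The associate norm is $\varrho'(g)=\sup\{\int fg: f\ge0,\ \varrho(f)\le1\}$, and $X'$ is the space it determines. The representation space $X(0,\infty)$ is the rearrangement-invariant space over $(0,\infty)$ with $\|f\|_X=\|f^*\|_{X(0,\infty)}$ for every measurable $f$ on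 $\mathbb R^n$. For a natural number $m\ge1$, $m<n$, consider the condition $$t^{\frac mn-1}\chi_{(1,\infty)}(t)\in X'(0,\infty),\tag{$C_m$}$$ let $\sigma_m(f)=\|t^{\frac mn}f^{**}(t)\|_{X'(0,\infty)}$ for nonnegative measurable $f$ on $\mathbb R^n$, and let $X^m$ be the space determined by $\sigma_m'$ (if $(C_m)$ holds, this is the optimal target space for $X$ in the $m$-th order Sobolev inequality $\|u\|_Y\le C\|\nabla^m u\|_X$). **Theorem.** Let $k,l\ge1$ be natural numbers with $k+l<n$ and put $m=k+l$. Let $X$ be a rearrangement-invariant space over $\mathbb R^n$ such that $(C_{k+l})$ holds. Then $(C_k)$ holds, $t^{\frac ln-1}\chi_{(1,\infty)}(t)\in(X^k)'(0,\infty)$, and the norms of $(X^k)^l$ and $X^{k+l}$ are equivalent: there are constants $C_1,C_2\in(0,\infty)$, depending only on $m$ and $n$, such that $$C_1\|f\|_{X^{k+l}}\le\|f\|_{(X^k)^l}\le C_2\|f\|_{X^{k+l}}\qquad\text{for every measurable } f:\mathbb R^n\to[-\infty,\infty].$$ -/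

import Mathlib

open MeasureTheory Set Filter Topology
open scoped ENNReal NNReal

noncomputable section

namespace RearrInv

/-- Euclidean space `ℝⁿ`, always with Lebesgue measure `volume`. -/
abbrev Rn (n : ℕ) : Type := EuclideanSpace ℝ (Fin n)

/-- Lebesgue measure on the half-line `(0,∞)`; functions on `(0,∞)` are functions on `ℝ`
considered up to this measure, so their values off `(0,∞)` are irrelevant. -/
abbrev halfLine : Measure ℝ := volume.restrict (Ioi 0)

section General

variable {α : Type*} [MeasurableSpace α]

/-- The nonincreasing rearrangement
`f*(t) = inf {c ∈ (0,∞) : μ {x : f x > c} ≤ t}` of a nonnegative extended-real function. -/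
def rearr (μ : Measure α) (f : α → ℝ≥0∞) (t : ℝ) : ℝ≥0∞ :=
  sInf {c : ℝ≥0∞ | 0 < c ∧ c < ∞ ∧ μ {x | c < f x} ≤ ENNReal.ofReal t}

/-- The maximal nonincreasing rearrangement `f**(t) = (1/t) ∫₀ᵗ f*(s) ds`, for `t > 0`. -/
def maxRearr (μ : Measure α) (f : α → ℝ≥0∞) (t : ℝ) : ℝ≥0∞ :=
  (∫⁻ s in Ioo 0 t, rearr μ f s) / ENNReal.ofReal t

/-- `ρ` is a rearrangement-invariant (Banach function) norm on the nonnegative `μ`-measurable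
functions. Only the values of `ρ` at `μ`-measurable (that is, `AEMeasurable`) functions matter. -/
structure IsRINorm (μ : Measure α) (ρ : (α → ℝ≥0∞) → ℝ≥0∞) : Prop where
  /-- (P1) definiteness -/
  eq_zero_iff : ∀ f, AEMeasurable f μ → (ρ f = 0 ↔ f =ᵐ[μ] 0)
  /-- (P1) positive homogeneity -/
  smul : ∀ (c : ℝ≥0) (f), AEMeasurable f μ → ρ (fun x => (c : ℝ≥0∞) * f x) = c * ρ f
  /-- (P1) triangle inequality -/
  add_le : ∀ f g, AEMeasurable f μ → AEMeasurable g μ → ρ (fun x => f x + g x) ≤ ρ f + ρ g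
  /-- (P2) lattice axiom -/
  mono : ∀ f g, AEMeasurable f μ → AEMeasurable g μ → f ≤ᵐ[μ] g → ρ f ≤ ρ g
  /-- (P3) Fatou axiom; that `ρ ∘ f` is nondecreasing is the lattice axiom -/
  fatou : ∀ (f : ℕ → α → ℝ≥0∞) (g : α → ℝ≥0∞), (∀ j, AEMeasurable (f j) μ) → AEMeasurable g μ →
    (∀ᵐ x ∂μ, Monotone fun j => f j x) →
    (∀ᵐ x ∂μ, Tendsto (fun j => f j x) atTop (𝓝 (g x))) →
    Tendsto (fun j => ρ (f j)) atTop (𝓝 (ρ g))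
  /-- (P4) nontriviality -/
  indicator_lt_top : ∀ E, MeasurableSet E → μ E < ∞ → ρ (E.indicator fun _ => 1) < ∞
  /-- (P5) local embedding in `L¹` -/
  setLIntegral_le : ∀ E, MeasurableSet E → μ E < ∞ →
    ∃ C : ℝ≥0, 0 < C ∧ ∀ f, AEMeasurable f μ → ∫⁻ x in E, f x ∂μ ≤ C * ρ f
  /-- (P6) rearrangement invariance -/
  eq_of_rearr_eq : ∀ f g, AEMeasurable f μ → AEMeasurable g μ →
    (∀ t, 0 < t → rearr μ f t = rearr μ g t) → ρ f = ρ g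

/-- The associate functional `ρ'(g) = sup {∫ f g dμ : f ≥ 0 measurable, ρ f ≤ 1}`. -/
def assoc (μ : Measure α) (ρ : (α → ℝ≥0∞) → ℝ≥0∞) (g : α → ℝ≥0∞) : ℝ≥0∞ :=
  ⨆ (f : α → ℝ≥0∞) (_ : AEMeasurable f μ) (_ : ρ f ≤ 1), ∫⁻ x, f x * g x ∂μ

/-- The quantity `‖f‖_X = ρ(|f|)`, for `X = X(ρ)` and `f` with values in `[-∞,∞]`. -/
def nrm (ρ : (α → ℝ≥0∞) → ℝ≥0∞) (f : α → EReal) : ℝ≥0∞ :=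
  ρ fun x => (f x).abs

/-- The space `X(ρ)` of all measurable `f` with `‖f‖_X < ∞`. -/
def space (μ : Measure α) (ρ : (α → ℝ≥0∞) → ℝ≥0∞) : Set (α → EReal) :=
  {f | AEMeasurable f μ ∧ nrm ρ f < ∞}

end General

/-- The norm of the representation space `X(0,∞)` of `X = X(ρ)` over `ℝⁿ`. For `f` on `(0,∞)`, the
radial function `x ↦ f*(|B(0,|x|)|)` on `ℝⁿ` is equimeasurable with `f`, so that
`‖f‖_{X(0,∞)}` is its norm in `X`. -/
def repr {n : ℕ} (ρ : (Rn n → ℝ≥0∞) → ℝ≥0∞) (f : ℝ → ℝ≥0∞) : ℝ≥0∞ :=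
  ρ fun x => rearr halfLine f (volume (Metric.ball (0 : Rn n) ‖x‖)).toReal

/-- The function `t ↦ t^(m/n - 1) χ_{(1,∞)}(t)`. -/
def tailPower (n m : ℕ) : ℝ → EReal :=
  fun t => (((Ioi (1 : ℝ)).indicator (fun s => s ^ ((m : ℝ) / n - 1)) t : ℝ) : EReal)

/-- `t^(m/n - 1) χ_{(1,∞)}(t)` belongs to `X'(0,∞)`, the representation space of the associate space
of `X = X(ρ)`. -/
def TargetCondition {n : ℕ} (m : ℕ) (ρ : (Rn n → ℝ≥0∞) → ℝ≥0∞) : Prop :=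
  tailPower n m ∈ space halfLine (repr (assoc volume ρ))

/-- The functional `σ_m(f) = ‖t^(m/n) f**(t)‖_{X'(0,∞)}`. -/
def sigma {n : ℕ} (m : ℕ) (ρ : (Rn n → ℝ≥0∞) → ℝ≥0∞) (f : Rn n → ℝ≥0∞) : ℝ≥0∞ :=
  repr (assoc volume ρ) fun t => ENNReal.ofReal (t ^ ((m : ℝ) / n)) * maxRearr volume f t

/-- The norm `σ_m'` of the optimal target space `X^m` for `X = X(ρ)`. -/
def optTarget {n : ℕ} (m : ℕ) (ρ : (Rn n → ℝ≥0∞) → ℝ≥0∞) : (Rn n → ℝ≥0∞) → ℝ≥0∞ :=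
  assoc volume (sigma m ρ)

end RearrInv

end

/-!
Write `‖·‖` for the norm of `X'(0,∞)`, `a = l/n`, `b = k/n`, and `f ↦ f°` for the radial
rearrangement onto `ℝⁿ` of a function on the half-line. Up to constants, the functional `σ_l` built
on `X^k` agrees with `σ_(k+l)` built on `X`; taking associates of both gives the equivalence of
`(X^k)^l` and `X^(k+l)`. By definition the former sends `g` to `σ_k''(G°)` with
`G(t) = t^(a-1) F(t)`, `F(t) = ∫₀ᵗ g*`, and the latter sends `g` to `‖H‖` with
`H(t) = t^(a+b-1) F(t) = t^b G(t)`. Only the monotonicity of `F` matters.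

The basic fact is that, for nondecreasing `F` and `0 ≤ γ ≤ 1`, the rearrangement of
`h(t) = t^(γ-1) F(t)` is pointwise comparable with `sup {h(s) : s ≥ t}`
(`rearr_le_supTail`, `supTail_powMul_le`): near its value at `s` such an `h` stays large on the long
interval `(s, 3s)`.

* Upper estimate, `σ_k''(G°) ≤ C ‖H‖`: homogeneity of `σ_k` gives `σ_k'' ≤ σ_k`
  (`assoc_assoc_le`), and `t^b (G°)**(t)` is pointwise at most a constant times
  `sup {H(s) : s ≥ t}`, because `G(s) ≤ s^(a-1) F(t)` for `s ≤ t` and `s^(a-1)` is integrable at `0`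
  (`powMul_rearrPrimitive_radialRearr_le`). The choice `F = χ_(1,∞)` yields the tail condition
  for `X^k`.
* Lower estimate, `‖H‖ ≤ C σ_k''(G°)`: if `ρ(f) ≤ 1`, then `∫ f H°` is at most a constant times
  integrals of `f(x) H(s(|B(x)|))` for measurable choices `s(t) ≥ t`, where `|B(x)|` is the volume
  of the ball of radius `|x|`. Bounding `G(s) ≤ (3/s) ∫₀ˢ G*` and exchanging the integrals turns
  them into `∫ φ G°` for a function `φ` whose norm in `X^k`, that is `σ_k'(φ)`, is at most `3`, by
  the basic fact applied to `t^b ψ**(t)` for each `ψ` with `σ_k(ψ) ≤ 1`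
  (`lintegral_mul_powMul_comp_le`).

Neither the full Lorentz–Luxemburg theorem `σ_k'' = σ_k` nor the Hardy–Littlewood inequality for two
arbitrary functions is needed.
-/

noncomputable section

namespace RearrInv

/-! ### Nonincreasing rearrangements -/

section Rearrangement

variable {α β : Type*} [MeasurableSpace α] [MeasurableSpace β] {μ : Measure α} {ν : Measure β}

lemma rearr_le_of_measure_le {f : α → ℝ≥0∞} {t : ℝ} {c : ℝ≥0∞}
    (h : μ {x | c < f x} ≤ ENNReal.ofReal t) : rearr μ f t ≤ c := by
  rcases eq_or_ne c ∞ with rfl | hc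
  · exact le_top
  refine le_of_forall_gt_imp_ge_of_dense fun d hd => ?_
  rcases eq_or_ne d ∞ with rfl | hd'
  · exact le_top
  exact sInf_le ⟨(zero_le).trans_lt hd, hd'.lt_top,
    (measure_mono fun x (hx : d < f x) => hd.trans hx).trans h⟩

lemma le_rearr_of_lt_measure {f : α → ℝ≥0∞} {t : ℝ} {c : ℝ≥0∞}
    (h : ENNReal.ofReal t < μ {x | c ≤ f x}) : c ≤ rearr μ f t := by
  refine le_sInf fun d hd => ?_
  by_contra! hdc
  exact (h.trans_le ((measure_mono fun x (hx : c ≤ f x) => hdc.trans_le hx).trans hd.2.2)).false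

lemma rearr_antitone (μ : Measure α) (f : α → ℝ≥0∞) : Antitone (rearr μ f) := fun _ _ hst =>
  sInf_le_sInf fun _ hc => ⟨hc.1, hc.2.1, hc.2.2.trans (ENNReal.ofReal_le_ofReal hst)⟩

lemma rearr_mono_ae {f g : α → ℝ≥0∞} (h : f ≤ᵐ[μ] g) (t : ℝ) : rearr μ f t ≤ rearr μ g t :=
  sInf_le_sInf fun _ hc => ⟨hc.1, hc.2.1,
    (measure_mono_ae (h.mono fun _ hx hcx => lt_of_lt_of_le hcx hx)).trans hc.2.2⟩

lemma rearr_congr_ae {f g : α → ℝ≥0∞} (h : f =ᵐ[μ] g) (t : ℝ) : rearr μ f t = rearr μ g t :=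
  le_antisymm (rearr_mono_ae h.le t) (rearr_mono_ae h.symm.le t)

lemma rearr_const_mul_le (f : α → ℝ≥0∞) {c : ℝ≥0} (hc : c ≠ 0) (t : ℝ) :
    rearr μ (fun x => (c : ℝ≥0∞) * f x) t ≤ c * rearr μ f t := by
  have hc0 : (c : ℝ≥0∞) ≠ 0 := by simpa using hc
  rw [← ENNReal.div_le_iff' hc0 ENNReal.coe_ne_top]
  refine le_sInf fun d hd => ?_
  rw [ENNReal.div_le_iff' hc0 ENNReal.coe_ne_top]
  refine rearr_le_of_measure_le ((measure_mono fun x hx => ?_).trans hd.2.2)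
  exact lt_of_mul_lt_mul_left' (a := (c : ℝ≥0∞)) hx

lemma rearr_comp_measurePreserving {v : α → β} (hv : MeasurePreserving v μ ν) {f : β → ℝ≥0∞}
    (hf : Measurable f) (t : ℝ) : rearr μ (fun x => f (v x)) t = rearr ν f t := by
  have (c : ℝ≥0∞) : μ {x | c < f (v x)} = ν {y | c < f y} :=
    hv.measure_preimage (measurableSet_lt measurable_const hf).nullMeasurableSet
  simp only [rearr, this]

lemma halfLine_le_of_subset_Iio {A : Set ℝ} {t : ℝ} (hA : ∀ s ∈ A, 0 < s → s < t) :
    halfLine A ≤ ENNReal.ofReal t := by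
  have h : halfLine A ≤ halfLine (Iio t) := by
    refine measure_mono_ae ?_
    filter_upwards [ae_restrict_mem measurableSet_Ioi] with s hs hsA using hA s hsA hs
  refine h.trans ?_
  rw [Measure.restrict_apply measurableSet_Iio, Iio_inter_Ioi, Real.volume_Ioo, sub_zero]

lemma rearr_le_of_antitoneOn {h : ℝ → ℝ≥0∞} (hh : AntitoneOn h (Ioi 0)) {t : ℝ} (ht : 0 < t) :
    rearr halfLine h t ≤ h t :=
  rearr_le_of_measure_le <| halfLine_le_of_subset_Iio fun s hs hs0 => by
    by_contra! hts
    exact (lt_of_lt_of_le hs (hh ht hs0 hts)).false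

/-- The layer cake formula for a function with values in `[0, ∞]`. -/
lemma lintegral_eq_lintegral_measure_ofReal_lt [SFinite μ] {φ : α → ℝ≥0∞} (hφ : Measurable φ) :
    ∫⁻ x, φ x ∂μ = ∫⁻ c in Ioi (0 : ℝ), μ {x | ENNReal.ofReal c < φ x} := by
  have layer (a : ℝ≥0∞) :
      a = ∫⁻ c in Ioi (0 : ℝ), {c : ℝ | ENNReal.ofReal c < a}.indicator 1 c := by
    rw [lintegral_indicator_one (measurableSet_lt ENNReal.measurable_ofReal measurable_const),
      Measure.restrict_apply (measurableSet_lt ENNReal.measurable_ofReal measurable_const)]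
    rcases eq_or_ne a ∞ with rfl | ha
    · simp
    · have : {c : ℝ | ENNReal.ofReal c < a} ∩ Ioi 0 = Ioo 0 a.toReal := by
        ext c
        simp only [mem_inter_iff, mem_ofPred_eq, mem_Ioi, mem_Ioo]
        constructor
        · rintro ⟨h1, h2⟩
          exact ⟨h2, (ENNReal.ofReal_lt_iff_lt_toReal h2.le ha).1 h1⟩
        · rintro ⟨h2, h1⟩
          exact ⟨(ENNReal.ofReal_lt_iff_lt_toReal h2.le ha).2 h1, h2⟩
      rw [this, Real.volume_Ioo, sub_zero, ENNReal.ofReal_toReal ha]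
  calc ∫⁻ x, φ x ∂μ
      = ∫⁻ x, (∫⁻ c in Ioi (0 : ℝ), {c : ℝ | ENNReal.ofReal c < φ x}.indicator 1 c) ∂μ :=
        lintegral_congr fun x => layer (φ x)
    _ = ∫⁻ c in Ioi (0 : ℝ), (∫⁻ x, {c : ℝ | ENNReal.ofReal c < φ x}.indicator 1 c ∂μ) := by
        refine lintegral_lintegral_swap (Measurable.aemeasurable ?_)
        exact (measurable_one.indicator (measurableSet_lt
          (ENNReal.measurable_ofReal.comp measurable_snd) (hφ.comp measurable_fst)) :
          Measurable ({p : α × ℝ | ENNReal.ofReal p.2 < φ p.1}.indicator (1 : α × ℝ → ℝ≥0∞)))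
    _ = ∫⁻ c in Ioi (0 : ℝ), μ {x | ENNReal.ofReal c < φ x} := by
        refine lintegral_congr fun c => ?_
        rw [← lintegral_indicator_one (measurableSet_lt measurable_const hφ)]
        rfl

/-- The integral of `ψ` over a set of measure `t` is at most `∫₀ᵗ ψ*`. -/
lemma setLIntegral_le_lintegral_rearr [SFinite μ] {ψ : α → ℝ≥0∞} (hψ : AEMeasurable ψ μ)
    {E : Set α} {t : ℝ} (hμE : μ E ≤ ENNReal.ofReal t) :
    ∫⁻ x in E, ψ x ∂μ ≤ ∫⁻ s in Ioo 0 t, rearr μ ψ s := by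
  wlog hm : Measurable ψ generalizing ψ
  · have hae := hψ.ae_eq_mk
    rw [lintegral_congr_ae (ae_restrict_of_ae hae)]
    simp only [rearr_congr_ae hae]
    exact this hψ.measurable_mk.aemeasurable hψ.measurable_mk
  rw [lintegral_eq_lintegral_measure_ofReal_lt hm,
    lintegral_eq_lintegral_measure_ofReal_lt (rearr_antitone μ ψ).measurable]
  refine lintegral_mono fun c => ?_
  simp only
  rw [Measure.restrict_apply (measurableSet_lt measurable_const hm),
    Measure.restrict_apply (measurableSet_lt measurable_const (rearr_antitone μ ψ).measurable)]
  set d := ENNReal.ofReal c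
  -- If `s < μ {d < ψ}`, then already `s < μ {d' ≤ ψ}` for some `d' > d`, so that `d < ψ*(s)`.
  have key : ∀ s : ℝ, ENNReal.ofReal s < μ {x | d < ψ x} → d < rearr μ ψ s := by
    intro s hs
    obtain ⟨u, hu_anti, hu_gt, hu_lim⟩ := exists_seq_strictAnti_tendsto' (show d < ∞ by simp [d])
    have hun : {x | d < ψ x} = ⋃ i, {x | u i ≤ ψ x} := by
      ext x
      simp only [mem_ofPred_eq, mem_iUnion]
      constructor
      · intro hx
        obtain ⟨i, hi⟩ := (hu_lim.eventually (gt_mem_nhds hx)).exists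
        exact ⟨i, hi.le⟩
      · rintro ⟨i, hi⟩
        exact (hu_gt i).1.trans_le hi
    have hmono : Monotone fun i => {x | u i ≤ ψ x} := fun i j hij x (hx : u i ≤ ψ x) =>
      (hu_anti.antitone hij).trans hx
    rw [hun, hmono.measure_iUnion] at hs
    obtain ⟨i, hi⟩ := lt_iSup_iff.1 hs
    exact (hu_gt i).1.trans_le (le_rearr_of_lt_measure hi)
  set A := min (μ ({x | d < ψ x} ∩ E)) (ENNReal.ofReal t)
  have hA1 : μ ({x | d < ψ x} ∩ E) = A :=
    (min_eq_left ((measure_mono inter_subset_right).trans hμE)).symm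
  have hAtop : A ≠ ∞ := ((min_le_right _ _).trans_lt ENNReal.ofReal_lt_top).ne
  rw [hA1]
  calc A = volume (Ioo 0 A.toReal) := by
        rw [Real.volume_Ioo, sub_zero, ENNReal.ofReal_toReal hAtop]
    _ ≤ volume ({s | d < rearr μ ψ s} ∩ Ioo 0 t) := by
        refine measure_mono fun s hs => ?_
        have hsA : ENNReal.ofReal s < A := (ENNReal.ofReal_lt_iff_lt_toReal hs.1.le hAtop).2 hs.2
        refine ⟨key s (hsA.trans_le ((min_le_left _ _).trans (measure_mono inter_subset_left))),
          hs.1, ?_⟩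
        by_contra! hts
        exact (hsA.trans_le ((min_le_right _ _).trans (ENNReal.ofReal_le_ofReal hts))).false

end Rearrangement

/-! ### The volume of balls as a measure-preserving map onto the half-line -/

section VolBall

variable {n : ℕ}

/-- The volume of the ball centred at the origin whose boundary contains `x`. -/
def volBall (x : Rn n) : ℝ := (volume (Metric.ball (0 : Rn n) ‖x‖)).toReal

lemma measurePreserving_volBall (hn : 0 < n) :
    MeasurePreserving (volBall : Rn n → ℝ) volume halfLine := by
  have hfin : Module.finrank ℝ (Rn n) = n := finrank_euclideanSpace_fin
  have : Nontrivial (Rn n) := Module.nontrivial_of_finrank_pos (R := ℝ) (by rw [hfin]; exact hn)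
  have hball (r : ℝ) (hr : 0 ≤ r) : volume (Metric.ball (0 : Rn n) r)
      = ENNReal.ofReal (r ^ n) * volume (Metric.ball (0 : Rn n) 1) := by
    rw [Measure.addHaar_ball _ _ hr, hfin]
  set ω : ℝ := (volume (Metric.ball (0 : Rn n) 1)).toReal with hω
  have hωpos : 0 < ω := ENNReal.toReal_pos (Metric.measure_ball_pos _ _ one_pos).ne'
    measure_ball_lt_top.ne
  have hω' : volume (Metric.ball (0 : Rn n) 1) = ENNReal.ofReal ω :=
    (ENNReal.ofReal_toReal measure_ball_lt_top.ne).symm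
  have hv (x : Rn n) : volBall x = ‖x‖ ^ n * ω := by
    rw [volBall, hball _ (norm_nonneg x), ENNReal.toReal_mul, ENNReal.toReal_ofReal (by positivity)]
  have hmeas : Measurable (volBall : Rn n → ℝ) := by
    have : (volBall : Rn n → ℝ) = fun x => ‖x‖ ^ n * ω := funext hv
    rw [this]
    fun_prop
  have hIio (t : ℝ) : Measure.map (volBall : Rn n → ℝ) volume (Iio t) = ENNReal.ofReal t := by
    rw [Measure.map_apply hmeas measurableSet_Iio]
    rcases le_or_gt t 0 with ht | ht
    · have : (volBall : Rn n → ℝ) ⁻¹' Iio t = ∅ := by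
        refine eq_empty_of_forall_notMem fun x (hx : volBall x < t) => ?_
        exact (hx.trans_le ht).not_ge ENNReal.toReal_nonneg
      rw [this, measure_empty, ENNReal.ofReal_of_nonpos ht]
    · set r : ℝ := (t / ω) ^ ((n : ℝ)⁻¹) with hr
      have hr0 : 0 ≤ r := by positivity
      have hrn : r ^ n = t / ω := Real.rpow_inv_natCast_pow (by positivity) hn.ne'
      have : (volBall : Rn n → ℝ) ⁻¹' Iio t = Metric.ball 0 r := by
        ext x
        rw [mem_preimage, mem_Iio, hv, mem_ball_zero_iff, ← lt_div_iff₀ hωpos, ← hrn,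
          pow_lt_pow_iff_left₀ (norm_nonneg x) hr0 hn.ne']
      rw [this, hball r hr0, hω', hrn, ← ENNReal.ofReal_mul (by positivity),
        div_mul_cancel₀ _ hωpos.ne']
  have hIio' (t : ℝ) : halfLine (Iio t) = ENNReal.ofReal t := by
    rw [Measure.restrict_apply measurableSet_Iio, Iio_inter_Ioi, Real.volume_Ioo, sub_zero]
  refine ⟨hmeas, Measure.ext_of_generateFrom_of_iUnion (range Iio) (fun k : ℕ => Iio (k : ℝ))
    ((BorelSpace.measurable_eq).trans (borel_eq_generateFrom_Iio ℝ)) isPiSystem_Iio ?_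
    (fun k => mem_range_self _) (fun k => by rw [hIio]; exact ENNReal.ofReal_ne_top) ?_⟩
  · exact eq_univ_of_forall fun x => mem_iUnion.2 (exists_nat_gt x)
  · rintro _ ⟨t, rfl⟩
    rw [hIio, hIio']

lemma ae_volBall_pos (hn : 0 < n) : ∀ᵐ x : Rn n, 0 < volBall x :=
  (measurePreserving_volBall hn).quasiMeasurePreserving.ae (ae_restrict_mem measurableSet_Ioi)

lemma setLIntegral_comp_volBall (hn : 0 < n) {h : ℝ → ℝ≥0∞} (hh : Measurable h) (t : ℝ) :
    ∫⁻ x in {x : Rn n | volBall x < t}, h (volBall x) = ∫⁻ s in Ioo 0 t, h s := by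
  have := (measurePreserving_volBall hn).setLIntegral_comp_preimage
    (measurableSet_Iio (a := t)) hh
  rw [Measure.restrict_restrict measurableSet_Iio, Iio_inter_Ioi] at this
  exact this

lemma volume_volBall_lt (hn : 0 < n) (t : ℝ) :
    volume {x : Rn n | volBall x < t} = ENNReal.ofReal t := by
  have := (measurePreserving_volBall hn).measure_preimage
    (measurableSet_Iio (a := t)).nullMeasurableSet
  rw [Measure.restrict_apply measurableSet_Iio, Iio_inter_Ioi, Real.volume_Ioo, sub_zero] at this
  exact this

end VolBall

/-! ### Power weights times nondecreasing functions -/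

section PowMul

/-- The function `t ↦ t^(γ - 1) F(t)`, meant for `t > 0`. With `F(t) = ∫₀ᵗ f*` it is `t^γ f**(t)`. -/
def powMul (γ : ℝ) (F : ℝ → ℝ≥0∞) (t : ℝ) : ℝ≥0∞ := ENNReal.ofReal (t ^ (γ - 1)) * F t

/-- The least nonincreasing majorant `t ↦ sup {h(s) : s ≥ t}`. -/
def supTail (h : ℝ → ℝ≥0∞) (t : ℝ) : ℝ≥0∞ := ⨆ (s : ℝ) (_ : t ≤ s), h s

lemma le_supTail (h : ℝ → ℝ≥0∞) {s t : ℝ} (hst : t ≤ s) : h s ≤ supTail h t :=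
  le_iSup₂ (f := fun (s : ℝ) (_ : t ≤ s) => h s) s hst

lemma supTail_antitone (h : ℝ → ℝ≥0∞) : Antitone (supTail h) := fun _ _ hst =>
  iSup₂_le fun _ hr => le_supTail h (hst.trans hr)

lemma rearr_le_supTail (h : ℝ → ℝ≥0∞) (t : ℝ) : rearr halfLine h t ≤ supTail h t :=
  rearr_le_of_measure_le <| halfLine_le_of_subset_Iio fun s hs _ => by
    by_contra! hts
    exact (lt_of_lt_of_le hs (le_supTail h hts)).false

variable {γ : ℝ} {F : ℝ → ℝ≥0∞}

lemma measurable_powMul (γ : ℝ) (hF : Monotone F) : Measurable (powMul γ F) := by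
  have := hF.measurable
  unfold powMul
  fun_prop

/-- On `(s, 3s)` the function `t^(γ - 1) F(t)` stays above a third of its value at `s`, and this
interval is longer than any `t ≤ s`. -/
lemma supTail_powMul_le (h0 : 0 ≤ γ) (h1 : γ ≤ 1) (hF : Monotone F) {t : ℝ} (ht : 0 < t) :
    supTail (powMul γ F) t ≤ 3 * rearr halfLine (powMul γ F) t := by
  refine iSup₂_le fun s hts => ?_
  have hs : 0 < s := ht.trans_le hts
  rw [← ENNReal.div_le_iff' (by norm_num) (by norm_num)]
  refine le_rearr_of_lt_measure (lt_of_lt_of_le ?_ (measure_mono (s := Ioo s (3 * s)) ?_))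
  · rw [Measure.restrict_apply measurableSet_Ioo,
      inter_eq_left.2 (Ioo_subset_Ioi_self.trans (Ioi_subset_Ioi hs.le)), Real.volume_Ioo]
    exact (ENNReal.ofReal_lt_ofReal_iff (by linarith)).2 (by linarith)
  · intro r hr
    rw [mem_ofPred_eq, powMul, powMul, mul_comm, mul_div_assoc, mul_comm]
    refine mul_le_mul' ?_ (hF hr.1.le)
    rw [ENNReal.div_le_iff' (by norm_num) (by norm_num), ← ENNReal.ofReal_ofNat,
      ← ENNReal.ofReal_mul (by norm_num)]
    refine ENNReal.ofReal_le_ofReal ?_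
    calc s ^ (γ - 1) = 3 ^ (1 - γ) * (3 * s) ^ (γ - 1) := by
          rw [Real.mul_rpow (by norm_num) hs.le, ← mul_assoc, ← Real.rpow_add (by norm_num)]
          norm_num
      _ ≤ 3 ^ (1 : ℝ) * r ^ (γ - 1) := by
          refine mul_le_mul (Real.rpow_le_rpow_of_exponent_le (by norm_num) (by linarith))
            (Real.rpow_le_rpow_of_nonpos (hs.trans hr.1) hr.2.le (by linarith))
            (by positivity) (by positivity)
      _ = 3 * r ^ (γ - 1) := by rw [Real.rpow_one]

/-- Up to a factor `2`, the supremum of `t^(γ - 1) F(t)` over `[t, ∞)` is attained along the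
points `2^i t`. -/
lemma supTail_powMul_le_iSup_two_pow (h0 : 0 ≤ γ) (h1 : γ ≤ 1) (hF : Monotone F) {t : ℝ}
    (ht : 0 < t) : supTail (powMul γ F) t ≤ 2 * ⨆ i : ℕ, powMul γ F (2 ^ i * t) := by
  refine iSup₂_le fun s hts => ?_
  obtain ⟨i, hi1, hi2⟩ := exists_nat_pow_near ((one_le_div ht).2 hts) (one_lt_two (α := ℝ))
  rw [le_div_iff₀ ht] at hi1
  rw [div_lt_iff₀ ht] at hi2
  have hpos : 0 < 2 ^ i * t := by positivity
  refine le_trans ?_ (mul_le_mul_right (le_iSup (fun i : ℕ => powMul γ F (2 ^ i * t)) (i + 1)) 2)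
  rw [powMul, powMul, ← mul_assoc]
  refine mul_le_mul' ?_ (hF hi2.le)
  rw [← ENNReal.ofReal_ofNat, ← ENNReal.ofReal_mul (by norm_num)]
  refine ENNReal.ofReal_le_ofReal ?_
  calc s ^ (γ - 1) ≤ (2 ^ i * t) ^ (γ - 1) := Real.rpow_le_rpow_of_nonpos hpos hi1 (by linarith)
    _ = 2 ^ (1 - γ) * (2 ^ (i + 1) * t) ^ (γ - 1) := by
        rw [show (2 : ℝ) ^ (i + 1) * t = 2 * (2 ^ i * t) by ring,
          Real.mul_rpow (by norm_num) hpos.le, ← mul_assoc, ← Real.rpow_add (by norm_num)]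
        norm_num
    _ ≤ 2 ^ (1 : ℝ) * (2 ^ (i + 1) * t) ^ (γ - 1) := by
        gcongr
        · norm_num
        · linarith
    _ = 2 * (2 ^ (i + 1) * t) ^ (γ - 1) := by rw [Real.rpow_one]

/-- A measurable choice, for every `t`, of a maximum point of `h` among `t, 2t, …, 2^N t`. -/
lemma exists_measurable_max_two_pow {h : ℝ → ℝ≥0∞} (hh : Measurable h) (N : ℕ) :
    ∃ s : ℝ → ℝ, Measurable s ∧ (∀ t, 0 < t → t ≤ s t) ∧
      ∀ t, ∀ i ≤ N, h (2 ^ i * t) ≤ h (s t) := by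
  induction N with
  | zero => exact ⟨id, measurable_id, fun t _ => le_rfl, fun t i hi => by simp_all⟩
  | succ N ih =>
    obtain ⟨s, hs, hts, hmax⟩ := ih
    refine ⟨fun t => if h (s t) < h (2 ^ (N + 1) * t) then 2 ^ (N + 1) * t else s t,
      Measurable.ite (measurableSet_lt (by fun_prop) (by fun_prop)) (by fun_prop) hs, ?_, ?_⟩
    · intro t ht
      dsimp only
      split_ifs
      · exact le_mul_of_one_le_left ht.le (one_le_pow₀ one_le_two)
      · exact hts t ht
    · intro t i hi
      dsimp only
      rcases Nat.lt_or_ge N i with hNi | hiN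
      · obtain rfl : i = N + 1 := by omega
        split_ifs with hlt
        · exact le_rfl
        · exact not_lt.1 hlt
      · split_ifs with hlt
        · exact (hmax t i hiN).trans hlt.le
        · exact hmax t i hiN

end PowMul

/-! ### Associate functionals of positively homogeneous functionals -/

section Assoc

variable {α : Type*} [MeasurableSpace α] {μ : Measure α} {σ σ₁ σ₂ : (α → ℝ≥0∞) → ℝ≥0∞}

lemma lintegral_mul_le_assoc {f : α → ℝ≥0∞} (hf : AEMeasurable f μ) (hσ : σ f ≤ 1)
    (g : α → ℝ≥0∞) : ∫⁻ x, f x * g x ∂μ ≤ assoc μ σ g :=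
  le_iSup_of_le f (le_iSup₂_of_le hf hσ le_rfl)

lemma assoc_le {g : α → ℝ≥0∞} {c : ℝ≥0∞}
    (h : ∀ f, AEMeasurable f μ → σ f ≤ 1 → ∫⁻ x, f x * g x ∂μ ≤ c) : assoc μ σ g ≤ c :=
  iSup_le fun f => iSup₂_le (h f)

lemma assoc_le_const_mul {g h : α → ℝ≥0∞} {c : ℝ≥0}
    (hgh : ∀ᵐ x ∂μ, g x ≤ c * h x) : assoc μ σ g ≤ c * assoc μ σ h :=
  assoc_le fun f hf hσ => calc
    ∫⁻ x, f x * g x ∂μ ≤ ∫⁻ x, c * (f x * h x) ∂μ := lintegral_mono_ae <| hgh.mono fun x hx => by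
        rw [mul_left_comm]
        exact mul_le_mul_right hx (f x)
    _ = c * ∫⁻ x, f x * h x ∂μ := lintegral_const_mul' _ _ ENNReal.coe_ne_top
    _ ≤ c * assoc μ σ h := mul_le_mul_right (lintegral_mul_le_assoc hf hσ h) _

lemma lintegral_mul_le_mul_assoc
    (hom : ∀ c : ℝ≥0, c ≠ 0 → ∀ f, σ (fun x => (c : ℝ≥0∞) * f x) ≤ c * σ f)
    {f : α → ℝ≥0∞} (hf : AEMeasurable f μ) {c : ℝ≥0} (hc : c ≠ 0) (hσ : σ f ≤ c)
    (g : α → ℝ≥0∞) : ∫⁻ x, f x * g x ∂μ ≤ c * assoc μ σ g := by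
  have hc' : (c : ℝ≥0∞) ≠ 0 := by simpa using hc
  have h1 : σ (fun x => ((c⁻¹ : ℝ≥0) : ℝ≥0∞) * f x) ≤ 1 := by
    refine (hom c⁻¹ (inv_ne_zero hc) f).trans ((mul_le_mul_right hσ _).trans ?_)
    rw [ENNReal.coe_inv hc, ENNReal.inv_mul_cancel hc' ENNReal.coe_ne_top]
  have h2 := lintegral_mul_le_assoc (hf.const_mul _) h1 g
  calc ∫⁻ x, f x * g x ∂μ = c * ∫⁻ x, ((c⁻¹ : ℝ≥0) : ℝ≥0∞) * f x * g x ∂μ := by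
        rw [← lintegral_const_mul' _ _ ENNReal.coe_ne_top]
        refine lintegral_congr fun x => ?_
        rw [← mul_assoc, ← mul_assoc, ENNReal.coe_inv hc,
          ENNReal.mul_inv_cancel hc' ENNReal.coe_ne_top, one_mul]
    _ ≤ c * assoc μ σ g := mul_le_mul_right h2 _

/-- The easy half of the Lorentz–Luxemburg theorem: the second associate functional never exceeds
the original one. -/
lemma assoc_assoc_le
    (hom : ∀ c : ℝ≥0, c ≠ 0 → ∀ f, σ (fun x => (c : ℝ≥0∞) * f x) ≤ c * σ f)
    {u : α → ℝ≥0∞} (hu : AEMeasurable u μ) : assoc μ (assoc μ σ) u ≤ σ u := by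
  refine assoc_le fun φ _ hφ => le_of_forall_gt_imp_ge_of_dense fun d hd => ?_
  rcases eq_or_ne d ∞ with rfl | hd'
  · exact le_top
  lift d to ℝ≥0 using hd'
  have hd0 : d ≠ 0 := by
    rintro rfl
    simp at hd
  calc ∫⁻ x, φ x * u x ∂μ = ∫⁻ x, u x * φ x ∂μ := lintegral_congr fun x => mul_comm _ _
    _ ≤ d * assoc μ σ φ := lintegral_mul_le_mul_assoc hom hu hd0 hd.le φ
    _ ≤ d := by simpa using mul_le_mul_right hφ (d : ℝ≥0∞)

lemma assoc_anti
    (hom : ∀ c : ℝ≥0, c ≠ 0 → ∀ f, σ₁ (fun x => (c : ℝ≥0∞) * f x) ≤ c * σ₁ f)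
    {c : ℝ≥0} (hc : c ≠ 0) (h : ∀ f, AEMeasurable f μ → σ₁ f ≤ c * σ₂ f) (g : α → ℝ≥0∞) :
    assoc μ σ₂ g ≤ c * assoc μ σ₁ g :=
  assoc_le fun f hf hσ => lintegral_mul_le_mul_assoc hom hf hc
    ((h f hf).trans (by simpa using mul_le_mul_right hσ (c : ℝ≥0∞))) g

end Assoc

/-! ### The functionals `σ_m` -/

section Sigma

variable {n : ℕ} {ρ : (Rn n → ℝ≥0∞) → ℝ≥0∞}

lemma repr_assoc_le_const_mul (hn : 0 < n) {f g : ℝ → ℝ≥0∞} {c : ℝ≥0}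
    (h : ∀ t, 0 < t → rearr halfLine f t ≤ c * rearr halfLine g t) :
    repr (assoc volume ρ) f ≤ c * repr (assoc volume ρ) g :=
  assoc_le_const_mul <| (ae_volBall_pos hn).mono fun _ hx => h _ hx

lemma repr_congr {f g : ℝ → ℝ≥0∞} (h : ∀ t, 0 < t → f t = g t) : repr ρ f = repr ρ g := by
  have : f =ᵐ[halfLine] g := (ae_restrict_mem measurableSet_Ioi).mono fun t ht => h t ht
  simp only [repr, rearr_congr_ae this]

lemma repr_assoc_mono (hn : 0 < n) {f g : ℝ → ℝ≥0∞} (h : ∀ t, 0 < t → f t ≤ g t) :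
    repr (assoc volume ρ) f ≤ repr (assoc volume ρ) g := by
  have : f ≤ᵐ[halfLine] g := (ae_restrict_mem measurableSet_Ioi).mono fun t ht => h t ht
  simpa using repr_assoc_le_const_mul (ρ := ρ) hn (c := 1) fun t _ => by
    simpa using rearr_mono_ae this t

/-- The primitive `t ↦ ∫₀ᵗ f*` of the rearrangement. -/
def rearrPrimitive (f : Rn n → ℝ≥0∞) (t : ℝ) : ℝ≥0∞ := ∫⁻ s in Ioo 0 t, rearr volume f s

lemma monotone_rearrPrimitive (f : Rn n → ℝ≥0∞) : Monotone (rearrPrimitive f) := fun _ _ hst =>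
  lintegral_mono_set (Ioo_subset_Ioo_right hst)

lemma ofReal_rpow_mul_div (γ : ℝ) (a : ℝ≥0∞) {t : ℝ} (ht : 0 < t) :
    ENNReal.ofReal (t ^ γ) * (a / ENNReal.ofReal t) = ENNReal.ofReal (t ^ (γ - 1)) * a := by
  rw [Real.rpow_sub_one ht.ne', ENNReal.ofReal_div_of_pos ht, div_eq_mul_inv, div_eq_mul_inv]
  ring

/-- `σ_k(f)` is the norm of `t^(k/n - 1) ∫₀ᵗ f*`, which is of the form covered by `powMul`. -/
lemma sigma_eq (k : ℕ) (ρ : (Rn n → ℝ≥0∞) → ℝ≥0∞) (f : Rn n → ℝ≥0∞) :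
    sigma k ρ f = repr (assoc volume ρ) (powMul ((k : ℝ) / n) (rearrPrimitive f)) :=
  repr_congr fun _ ht => ofReal_rpow_mul_div _ _ ht

lemma sigma_const_mul_le (hn : 0 < n) (k : ℕ) (ρ : (Rn n → ℝ≥0∞) → ℝ≥0∞) (c : ℝ≥0) (hc : c ≠ 0)
    (f : Rn n → ℝ≥0∞) : sigma k ρ (fun x => (c : ℝ≥0∞) * f x) ≤ c * sigma k ρ f := by
  rw [sigma_eq, sigma_eq]
  refine repr_assoc_le_const_mul hn fun t _ =>
    (rearr_mono_ae (Eventually.of_forall fun s => ?_) t).trans (rearr_const_mul_le _ hc t)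
  rw [powMul, powMul, mul_left_comm]
  refine mul_le_mul_right ?_ _
  rw [rearrPrimitive, rearrPrimitive, ← lintegral_const_mul' _ _ ENNReal.coe_ne_top]
  exact lintegral_mono fun r => rearr_const_mul_le f hc r

/-- The radially nonincreasing function on `ℝⁿ` that is equimeasurable with `h`. -/
def radialRearr (n : ℕ) (h : ℝ → ℝ≥0∞) (x : Rn n) : ℝ≥0∞ := rearr halfLine h (volBall x)

lemma aemeasurable_radialRearr (hn : 0 < n) (h : ℝ → ℝ≥0∞) :
    AEMeasurable (radialRearr n h) volume :=
  ((rearr_antitone halfLine h).measurable.comp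
    (measurePreserving_volBall hn).measurable).aemeasurable

/-! ### The upper estimate -/

lemma lintegral_Ioo_rpow {a t : ℝ} (ha : 0 < a) (ht : 0 < t) :
    ∫⁻ s in Ioo 0 t, ENNReal.ofReal (s ^ (a - 1)) = ENNReal.ofReal (t ^ a / a) := by
  have hint : IntegrableOn (fun s : ℝ => s ^ (a - 1)) (Ioc 0 t) := by
    rw [← intervalIntegrable_iff_integrableOn_Ioc_of_le ht.le]
    exact intervalIntegral.intervalIntegrable_rpow' (by linarith)
  rw [restrict_Ioo_eq_restrict_Ioc, ← ofReal_integral_eq_lintegral_ofReal hint,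
    ← intervalIntegral.integral_of_le ht.le, integral_rpow (Or.inl (by linarith))]
  · simp [Real.zero_rpow ha.ne']
  · filter_upwards [ae_restrict_mem measurableSet_Ioc] with s hs
    exact Real.rpow_nonneg hs.1.le _

variable {F : ℝ → ℝ≥0∞} {a b : ℝ}

/-- The pointwise form of the upper estimate. For `s < t` the supremum of `r^(a - 1) F(r)` over
`[s, ∞)` is at most `s^(a - 1) F(t)` plus the supremum over `[t, ∞)`, and both terms can be
integrated over `(0, t)`. -/
lemma powMul_rearrPrimitive_radialRearr_le (hn : 0 < n) (ha : 0 < a) (ha1 : a ≤ 1) (hb : 0 ≤ b)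
    (hF : Monotone F) {t : ℝ} (ht : 0 < t) :
    powMul b (rearrPrimitive (radialRearr n (powMul a F))) t
      ≤ (ENNReal.ofReal a⁻¹ + 1) * supTail (powMul (a + b) F) t := by
  set G := powMul a F with hG
  have h1 (s : ℝ) (hs : s ∈ Ioo 0 t) : rearr volume (radialRearr n G) s
      ≤ ENNReal.ofReal (s ^ (a - 1)) * F t + supTail G t := by
    calc rearr volume (radialRearr n G) s
        = rearr halfLine (rearr halfLine G) s := rearr_comp_measurePreserving
          (measurePreserving_volBall hn) (rearr_antitone halfLine G).measurable s
      _ ≤ rearr halfLine G s := rearr_le_of_antitoneOn ((rearr_antitone _ _).antitoneOn _) hs.1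
      _ ≤ supTail G s := rearr_le_supTail G s
      _ ≤ _ := iSup₂_le fun r hr => by
        rcases le_total r t with hrt | hrt
        · refine le_add_right (mul_le_mul' (ENNReal.ofReal_le_ofReal ?_) (hF hrt))
          exact Real.rpow_le_rpow_of_nonpos hs.1 hr (by linarith)
        · exact le_add_left (le_supTail G hrt)
  have h2 : rearrPrimitive (radialRearr n G) t
      ≤ ENNReal.ofReal (t ^ a / a) * F t + ENNReal.ofReal t * supTail G t := by
    refine (setLIntegral_mono' measurableSet_Ioo h1).trans ?_
    rw [lintegral_add_right _ measurable_const, lintegral_mul_const _ (by fun_prop),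
      lintegral_Ioo_rpow ha ht, lintegral_const, Measure.restrict_apply_univ, Real.volume_Ioo,
      sub_zero, mul_comm (supTail G t)]
  have h3 : ENNReal.ofReal (t ^ b) * supTail G t ≤ supTail (powMul (a + b) F) t := by
    rw [supTail, ENNReal.mul_iSup]
    refine iSup_le fun r => ?_
    rw [ENNReal.mul_iSup]
    refine iSup_le fun hr => le_trans ?_ (le_supTail _ hr)
    have hr0 : 0 < r := ht.trans_le hr
    rw [hG, powMul, powMul, ← mul_assoc, ← ENNReal.ofReal_mul (by positivity)]
    refine mul_le_mul_left (ENNReal.ofReal_le_ofReal ?_) _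
    rw [show a + b - 1 = b + (a - 1) by ring, Real.rpow_add hr0]
    gcongr
  calc powMul b (rearrPrimitive (radialRearr n G)) t
      ≤ ENNReal.ofReal (t ^ (b - 1)) *
          (ENNReal.ofReal (t ^ a / a) * F t + ENNReal.ofReal t * supTail G t) :=
        mul_le_mul_right h2 _
    _ = ENNReal.ofReal a⁻¹ * powMul (a + b) F t + ENNReal.ofReal (t ^ b) * supTail G t := by
        rw [mul_add, powMul, ← mul_assoc, ← mul_assoc, ← mul_assoc,
          ← ENNReal.ofReal_mul (by positivity), ← ENNReal.ofReal_mul (by positivity),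
          ← ENNReal.ofReal_mul (by positivity)]
        congr 3
        · rw [show a + b - 1 = (b - 1) + a by ring, Real.rpow_add ht]
          ring
        · rw [← Real.rpow_add_one ht.ne', sub_add_cancel]
    _ ≤ ENNReal.ofReal a⁻¹ * supTail (powMul (a + b) F) t + supTail (powMul (a + b) F) t :=
        add_le_add (mul_le_mul_right (le_supTail _ le_rfl) _) h3
    _ = _ := by rw [add_mul, one_mul]

/-- The constant depends on `a` only through an upper bound `c` of `1 / a`. -/
lemma sigma_radialRearr_le (hn : 0 < n) {k : ℕ} (hkn : a + (k : ℝ) / n ≤ 1) (ha : 0 < a)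
    (hF : Monotone F) (ρ : (Rn n → ℝ≥0∞) → ℝ≥0∞) {c : ℝ≥0} (hc : a⁻¹ ≤ c) :
    sigma k ρ (radialRearr n (powMul a F))
      ≤ ((3 * (c + 1) : ℝ≥0) : ℝ≥0∞) * repr (assoc volume ρ) (powMul (a + (k : ℝ) / n) F) := by
  rw [sigma_eq]
  have hb : 0 ≤ (k : ℝ) / n := by positivity
  have hc' : ENNReal.ofReal a⁻¹ ≤ c := by
    rw [← ENNReal.ofReal_coe_nnreal]
    exact ENNReal.ofReal_le_ofReal hc
  refine repr_assoc_le_const_mul hn fun t ht => ?_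
  set H := powMul (a + (k : ℝ) / n) F
  calc _ ≤ rearr halfLine (fun t => ((c + 1 : ℝ≥0) : ℝ≥0∞) * supTail H t) t := by
        refine rearr_mono_ae ?_ t
        filter_upwards [ae_restrict_mem measurableSet_Ioi] with s hs
        refine (powMul_rearrPrimitive_radialRearr_le hn ha (by linarith) hb hF hs).trans ?_
        rw [ENNReal.coe_add, ENNReal.coe_one]
        gcongr
    _ ≤ ((c + 1 : ℝ≥0) : ℝ≥0∞) * supTail H t :=
        rearr_le_of_antitoneOn (fun _ _ _ _ hst => mul_le_mul_right (supTail_antitone H hst) _) ht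
    _ ≤ ((c + 1 : ℝ≥0) : ℝ≥0∞) * (3 * rearr halfLine H t) :=
        mul_le_mul_right (supTail_powMul_le (by positivity) hkn hF ht) _
    _ = _ := by
        rw [ENNReal.coe_mul]
        push_cast
        ring

/-! ### The lower estimate -/

lemma lintegral_lintegral_indicator_mul {u ψ : Rn n → ℝ≥0∞} (hu : AEMeasurable u volume)
    (hψ : AEMeasurable ψ volume) {v τ : Rn n → ℝ} (hv : Measurable v) (hτ : Measurable τ) :
    ∫⁻ y, ψ y * ∫⁻ x, {x | v y < τ x}.indicator u x
      = ∫⁻ x, u x * ∫⁻ y in {y | v y < τ x}, ψ y := by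
  have hind (x y : Rn n) : ψ y * {x | v y < τ x}.indicator u x
      = {p : Rn n × Rn n | v p.2 < τ p.1}.indicator (fun p => u p.1 * ψ p.2) (x, y) := by
    simp only [indicator, mem_ofPred_eq]
    split_ifs <;> simp [mul_comm]
  have hmeas : AEMeasurable ({p : Rn n × Rn n | v p.2 < τ p.1}.indicator
      (fun p => u p.1 * ψ p.2)) (volume.prod volume) :=
    (hu.comp_fst.mul hψ.comp_snd).indicator
      (measurableSet_lt (hv.comp measurable_snd) (hτ.comp measurable_fst))
  have hset (x : Rn n) : MeasurableSet {y | v y < τ x} := measurableSet_lt hv measurable_const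
  calc ∫⁻ y, ψ y * ∫⁻ x, {x | v y < τ x}.indicator u x
      = ∫⁻ y, ∫⁻ x, ψ y * {x | v y < τ x}.indicator u x := lintegral_congr fun y =>
        (lintegral_const_mul'' _
          (hu.indicator (measurableSet_lt measurable_const hτ))).symm
    _ = ∫⁻ x, ∫⁻ y, ψ y * {x | v y < τ x}.indicator u x := by
        simp only [hind]
        exact (lintegral_lintegral_swap (f := fun x y =>
          {p : Rn n × Rn n | v p.2 < τ p.1}.indicator (fun p => u p.1 * ψ p.2) (x, y)) hmeas).symm
    _ = ∫⁻ x, u x * ∫⁻ y in {y | v y < τ x}, ψ y := by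
        refine lintegral_congr fun x => ?_
        rw [← lintegral_indicator (hset x), ← lintegral_const_mul'' _ (hψ.indicator (hset x))]
        refine lintegral_congr fun y => ?_
        simp only [indicator, mem_ofPred_eq]
        split_ifs <;> simp [mul_comm]

/-- The duality step of the lower estimate. The function `t^(a + b - 1) F(t)`, sampled at a point
`s(t) ≥ t` and tested against `f` in the unit ball of `ρ`, is tested in another way:
with `b = k / n`, `v = volBall` and `τ = s ∘ v`, the function
`φ(y) = ∫ f(x) τ(x)^(b - 1) χ{v(y) < τ(x)} dx` satisfies `σ_k'(φ) ≤ 3`, and the integral of `φ`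
against the radial rearrangement of `t^(a - 1) F(t)` is at least a third of the given one. -/
lemma lintegral_mul_powMul_comp_le (hn : 0 < n) {k : ℕ} (hkn : a + (k : ℝ) / n ≤ 1) (ha : 0 < a)
    (hF : Monotone F) {f : Rn n → ℝ≥0∞} (hf : AEMeasurable f volume) (hρ : ρ f ≤ 1) {s : ℝ → ℝ}
    (hs : Measurable s) (hts : ∀ t, 0 < t → t ≤ s t) :
    ∫⁻ x, f x * powMul (a + (k : ℝ) / n) F (s (volBall x))
      ≤ 9 * assoc volume (assoc volume (sigma k ρ)) (radialRearr n (powMul a F)) := by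
  set b : ℝ := (k : ℝ) / n with hbdef
  have hb : 0 ≤ b := by positivity
  set G := powMul a F with hG
  have hv := (measurePreserving_volBall hn).measurable
  set τ : Rn n → ℝ := fun x => s (volBall x)
  have hτ : Measurable τ := hs.comp hv
  set u : Rn n → ℝ≥0∞ := fun x => f x * ENNReal.ofReal (τ x ^ (b - 1)) with hudef
  have hu : AEMeasurable u volume := hf.mul (by fun_prop)
  set φ : Rn n → ℝ≥0∞ := fun y => ∫⁻ x, {x | volBall y < τ x}.indicator u x with hφdef
  have hφ : AEMeasurable φ volume := by
    have : Antitone fun r : ℝ => ∫⁻ x, {x | r < τ x}.indicator u x := fun r r' hr =>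
      lintegral_mono (indicator_le_indicator_of_subset (fun x hx => lt_of_le_of_lt hr hx)
        (fun _ => zero_le))
    exact (this.measurable.comp hv).aemeasurable
  have hσφ : assoc volume (sigma k ρ) φ ≤ (3 : ℝ≥0) := by
    refine assoc_le fun ψ hψ hσ => ?_
    calc ∫⁻ y, ψ y * φ y = ∫⁻ x, u x * ∫⁻ y in {y | volBall y < τ x}, ψ y :=
          lintegral_lintegral_indicator_mul hu hψ hv hτ
      _ ≤ ∫⁻ x, ((3 : ℝ≥0) : ℝ≥0∞) *
            (f x * rearr halfLine (powMul b (rearrPrimitive ψ)) (volBall x)) := by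
          refine lintegral_mono_ae ?_
          filter_upwards [ae_volBall_pos hn] with x hx
          calc u x * ∫⁻ y in {y | volBall y < τ x}, ψ y
              ≤ u x * rearrPrimitive ψ (τ x) := mul_le_mul_right
                (setLIntegral_le_lintegral_rearr hψ (volume_volBall_lt hn _).le) _
            _ = f x * powMul b (rearrPrimitive ψ) (τ x) := by rw [hudef, powMul, mul_assoc]
            _ ≤ f x * (3 * rearr halfLine (powMul b (rearrPrimitive ψ)) (volBall x)) :=
                mul_le_mul_right ((le_supTail _ (hts _ hx)).trans
                  (supTail_powMul_le hb (by linarith) (monotone_rearrPrimitive ψ) hx)) _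
            _ = _ := by rw [mul_left_comm]; rfl
      _ = (3 : ℝ≥0) * ∫⁻ x, f x * rearr halfLine (powMul b (rearrPrimitive ψ)) (volBall x) :=
          lintegral_const_mul' _ _ ENNReal.coe_ne_top
      _ ≤ (3 : ℝ≥0) * sigma k ρ ψ := by
          rw [sigma_eq]
          exact mul_le_mul_right (lintegral_mul_le_assoc hf hρ _) _
      _ ≤ (3 : ℝ≥0) := by simpa using mul_le_mul_right hσ ((3 : ℝ≥0) : ℝ≥0∞)
  calc ∫⁻ x, f x * powMul (a + b) F (τ x)
      ≤ ∫⁻ x, 3 * (u x * ∫⁻ y in {y | volBall y < τ x}, radialRearr n G y) := by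
        refine lintegral_mono_ae ?_
        filter_upwards [ae_volBall_pos hn] with x hx
        have hτx : 0 < τ x := hx.trans_le (hts _ hx)
        rw [show ∫⁻ y in {y | volBall y < τ x}, radialRearr n G y
          = ∫⁻ r in Ioo 0 (τ x), rearr halfLine G r from
          setLIntegral_comp_volBall hn (rearr_antitone halfLine G).measurable (τ x)]
        have h1 : ENNReal.ofReal (τ x) * rearr halfLine G (τ x)
            ≤ ∫⁻ r in Ioo 0 (τ x), rearr halfLine G r := by
          calc _ = ∫⁻ r in Ioo 0 (τ x), rearr halfLine G (τ x) := by
                rw [setLIntegral_const, Real.volume_Ioo, sub_zero, mul_comm]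
            _ ≤ _ := setLIntegral_mono' measurableSet_Ioo fun r hr =>
                rearr_antitone halfLine G hr.2.le
        calc f x * powMul (a + b) F (τ x)
            = u x * (ENNReal.ofReal (τ x) * G (τ x)) := by
              have hpow : ENNReal.ofReal (τ x ^ (a + b - 1)) = ENNReal.ofReal (τ x ^ (b - 1)) *
                  (ENNReal.ofReal (τ x) * ENNReal.ofReal (τ x ^ (a - 1))) := by
                rw [← ENNReal.ofReal_mul hτx.le, ← ENNReal.ofReal_mul (by positivity), ← mul_assoc,
                  ← Real.rpow_add_one hτx.ne', ← Real.rpow_add hτx]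
                ring_nf
              rw [hG, powMul, powMul, hpow]
              simp only [hudef]
              ring
          _ ≤ u x * (ENNReal.ofReal (τ x) * (3 * rearr halfLine G (τ x))) := by
              refine mul_le_mul_right (mul_le_mul_right ?_ _) _
              exact (le_supTail G le_rfl).trans
                (supTail_powMul_le ha.le (by linarith) hF hτx)
          _ = 3 * (u x * (ENNReal.ofReal (τ x) * rearr halfLine G (τ x))) := by ring
          _ ≤ _ := mul_le_mul_right (mul_le_mul_right h1 _) _
    _ = 3 * ∫⁻ x, u x * ∫⁻ y in {y | volBall y < τ x}, radialRearr n G y :=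
        lintegral_const_mul' _ _ (by norm_num)
    _ = 3 * ∫⁻ y, φ y * radialRearr n G y := by
        rw [← lintegral_lintegral_indicator_mul hu (aemeasurable_radialRearr hn G) hv hτ]
        simp only [hφdef, mul_comm]
    _ ≤ 3 * ((3 : ℝ≥0) * assoc volume (assoc volume (sigma k ρ)) (radialRearr n G)) := by
        -- The associate functional of any functional is positively homogeneous.
        refine mul_le_mul_right (lintegral_mul_le_mul_assoc (fun c _ g => ?_) hφ three_ne_zero
          hσφ _) _
        exact assoc_le_const_mul (Eventually.of_forall fun _ => le_rfl)
    _ = 9 * assoc volume (assoc volume (sigma k ρ)) (radialRearr n G) := by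
        rw [← mul_assoc]
        norm_num

/-- The lower estimate: the supremum of `t^(γ - 1) F(t)` over `[t, ∞)` is exhausted by its values
at measurably chosen points `s(t) ≥ t`, to which the duality step applies. -/
lemma repr_assoc_powMul_le (hn : 0 < n) {k : ℕ} (hkn : a + (k : ℝ) / n ≤ 1) (ha : 0 < a)
    (hF : Monotone F) (ρ : (Rn n → ℝ≥0∞) → ℝ≥0∞) :
    repr (assoc volume ρ) (powMul (a + (k : ℝ) / n) F)
      ≤ 18 * assoc volume (assoc volume (sigma k ρ)) (radialRearr n (powMul a F)) := by
  have hγ : 0 ≤ a + (k : ℝ) / n := by positivity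
  set H := powMul (a + (k : ℝ) / n) F
  have hH : Measurable H := measurable_powMul _ hF
  have hv := (measurePreserving_volBall hn).measurable
  refine assoc_le fun f hf hρ => ?_
  set M : ℕ → Rn n → ℝ≥0∞ := fun N x => ⨆ (i : ℕ) (_ : i ≤ N), H (2 ^ i * volBall x)
  have hMmeas (N : ℕ) : Measurable (M N) := by
    refine Measurable.iSup fun i => Measurable.iSup fun _ => hH.comp (by fun_prop)
  have hMmono (x : Rn n) : Monotone fun N => M N x := fun N N' hN =>
    iSup₂_le fun i hi => le_iSup₂_of_le i (hi.trans hN) le_rfl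
  calc ∫⁻ x, f x * rearr halfLine H (volBall x)
      ≤ ∫⁻ x, 2 * ⨆ N, f x * M N x := by
        refine lintegral_mono_ae ?_
        filter_upwards [ae_volBall_pos hn] with x hx
        calc f x * rearr halfLine H (volBall x)
            ≤ f x * (2 * ⨆ i : ℕ, H (2 ^ i * volBall x)) := mul_le_mul_right
              ((rearr_le_supTail _ _).trans (supTail_powMul_le_iSup_two_pow hγ hkn hF hx)) _
          _ ≤ f x * (2 * ⨆ N, M N x) := by
              refine mul_le_mul_right (mul_le_mul_right (iSup_mono fun i => ?_) _) _
              exact le_iSup₂ (f := fun (j : ℕ) (_ : j ≤ i) => H (2 ^ j * volBall x)) i le_rfl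
          _ = 2 * ⨆ N, f x * M N x := by rw [mul_left_comm, ENNReal.mul_iSup]
    _ = 2 * ⨆ N, ∫⁻ x, f x * M N x := by
        rw [lintegral_const_mul' _ _ (by norm_num)]
        congr 1
        exact lintegral_iSup' (fun N => hf.mul (hMmeas N).aemeasurable)
          (Eventually.of_forall fun x N N' hN => mul_le_mul_right (hMmono x hN) _)
    _ ≤ 2 * (9 * assoc volume (assoc volume (sigma k ρ)) (radialRearr n (powMul a F))) := by
        refine mul_le_mul_right (iSup_le fun N => ?_) _
        obtain ⟨s, hs, hts, hmax⟩ := exists_measurable_max_two_pow hH N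
        refine le_trans (lintegral_mono fun x => mul_le_mul_right (iSup₂_le fun i hi => ?_) _)
          (lintegral_mul_powMul_comp_le hn hkn ha hF hf hρ hs hts)
        exact hmax (volBall x) i hi
    _ = _ := by
        rw [← mul_assoc]
        norm_num

end Sigma

/-! ### Iterated optimal targets -/

section Iteration

variable {n : ℕ}

lemma nrm_repr_tailPower (k : ℕ) (ρ : (Rn n → ℝ≥0∞) → ℝ≥0∞) :
    nrm (repr ρ) (tailPower n k)
      = repr ρ (powMul ((k : ℝ) / n) ((Ioi (1 : ℝ)).indicator 1)) := by
  refine repr_congr fun t ht => ?_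
  simp only [tailPower, powMul, EReal.abs_def, indicator]
  split_ifs
  · simp [abs_of_nonneg (Real.rpow_nonneg ht.le _)]
  · simp

lemma aemeasurable_tailPower (n k : ℕ) : AEMeasurable (tailPower n k) halfLine :=
  (measurable_coe_real_ereal.comp
    ((by fun_prop : Measurable fun s : ℝ => s ^ ((k : ℝ) / n - 1)).indicator
      measurableSet_Ioi)).aemeasurable

lemma monotone_indicator_Ioi_one : Monotone ((Ioi (1 : ℝ)).indicator (1 : ℝ → ℝ≥0∞)) := by
  intro s t hst
  simp only [indicator, mem_Ioi, Pi.one_apply]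
  split_ifs with h1 h2
  · exact le_rfl
  · exact absurd (h1.trans_le hst) h2
  · exact zero_le
  · exact le_rfl

variable {k l : ℕ}

lemma TargetCondition.of_le (hn : 0 < n) (hkl : k ≤ l) {ρ : (Rn n → ℝ≥0∞) → ℝ≥0∞}
    (h : TargetCondition l ρ) : TargetCondition k ρ := by
  refine ⟨aemeasurable_tailPower n k, lt_of_le_of_lt ?_ h.2⟩
  rw [nrm_repr_tailPower, nrm_repr_tailPower]
  refine repr_assoc_mono hn fun t _ => ?_
  simp only [powMul, indicator, mem_Ioi, Pi.one_apply]
  split_ifs with h1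
  · gcongr
    exact h1.le
  · simp

/-- For `F = ∫₀ᵗ f*` this says that the functional `σ_l` built on `X^k` is at most a constant times
`σ_(k+l)` built on `X`; for `F = χ_(1,∞)` it compares the tail conditions. -/
lemma sigma_optTarget_le (hn : 0 < n) (hl : 0 < l) (hkl : k + l ≤ n)
    (ρ : (Rn n → ℝ≥0∞) → ℝ≥0∞) {F : ℝ → ℝ≥0∞} (hF : Monotone F) :
    repr (assoc volume (optTarget k ρ)) (powMul ((l : ℝ) / n) F)
      ≤ ((3 * (n + 1) : ℝ≥0) : ℝ≥0∞) *
        repr (assoc volume ρ) (powMul (((k + l : ℕ) : ℝ) / n) F) := by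
  have hsum : (l : ℝ) / n + (k : ℝ) / n = ((k + l : ℕ) : ℝ) / n := by push_cast; ring
  have hn' : (0 : ℝ) < n := by exact_mod_cast hn
  have hl' : (1 : ℝ) ≤ l := by exact_mod_cast hl
  rw [← hsum]
  refine (assoc_assoc_le (sigma_const_mul_le hn k ρ) (aemeasurable_radialRearr hn _)).trans
    (sigma_radialRearr_le hn ?_ (by positivity) hF ρ ?_)
  · rw [hsum, div_le_one hn']
    exact_mod_cast hkl
  · rw [inv_div]
    exact div_le_self hn'.le hl'

lemma le_sigma_optTarget (hn : 0 < n) (hl : 0 < l) (hkl : k + l ≤ n)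
    (ρ : (Rn n → ℝ≥0∞) → ℝ≥0∞) {F : ℝ → ℝ≥0∞} (hF : Monotone F) :
    repr (assoc volume ρ) (powMul (((k + l : ℕ) : ℝ) / n) F)
      ≤ 18 * repr (assoc volume (optTarget k ρ)) (powMul ((l : ℝ) / n) F) := by
  have hsum : (l : ℝ) / n + (k : ℝ) / n = ((k + l : ℕ) : ℝ) / n := by push_cast; ring
  rw [← hsum]
  refine repr_assoc_powMul_le hn ?_ (by positivity) hF ρ
  rw [hsum, div_le_one (by exact_mod_cast hn)]
  exact_mod_cast hkl

end Iteration

end RearrInv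

end

theorem theorem3p2 (n m : ℕ) (hmn : m < n) :
    ∃ C₁ C₂ : ℝ≥0, 0 < C₁ ∧ 0 < C₂ ∧
      ∀ k l : ℕ, 1 ≤ k → 1 ≤ l → k + l = m →
      ∀ ρ : (RearrInv.Rn n → ℝ≥0∞) → ℝ≥0∞, RearrInv.IsRINorm volume ρ →
        RearrInv.TargetCondition (k + l) ρ →
          RearrInv.TargetCondition k ρ ∧
          RearrInv.tailPower n l ∈
            RearrInv.space RearrInv.halfLine
              (RearrInv.repr (RearrInv.assoc volume (RearrInv.optTarget k ρ))) ∧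
          ∀ f : RearrInv.Rn n → EReal, AEMeasurable f volume →
            C₁ * RearrInv.nrm (RearrInv.optTarget (k + l) ρ) f
                ≤ RearrInv.nrm (RearrInv.optTarget l (RearrInv.optTarget k ρ)) f ∧
            RearrInv.nrm (RearrInv.optTarget l (RearrInv.optTarget k ρ)) f
                ≤ C₂ * RearrInv.nrm (RearrInv.optTarget (k + l) ρ) f := by
  rcases Nat.eq_zero_or_pos n with rfl | hn
  · exact absurd hmn (Nat.not_lt_zero m)
  have hc0 : (3 * (n + 1) : ℝ≥0) ≠ 0 := by positivity
  refine ⟨(3 * (n + 1))⁻¹, 18, by positivity, by norm_num, ?_⟩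
  rintro k l - hl hkl ρ - hT
  have hkln : k + l ≤ n := by omega
  refine ⟨hT.of_le hn (Nat.le_add_right k l), ⟨RearrInv.aemeasurable_tailPower n l, ?_⟩, ?_⟩
  · have h2 := hT.2
    rw [RearrInv.nrm_repr_tailPower] at h2 ⊢
    exact (RearrInv.sigma_optTarget_le hn hl hkln ρ
      RearrInv.monotone_indicator_Ioi_one).trans_lt (ENNReal.mul_lt_top ENNReal.coe_lt_top h2)
  · intro f _
    constructor
    · have h := RearrInv.assoc_anti (σ₁ := RearrInv.sigma l (RearrInv.optTarget k ρ))
        (σ₂ := RearrInv.sigma (k + l) ρ) (μ := volume) (RearrInv.sigma_const_mul_le hn l _) hc0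
        (fun g _ => by
          rw [RearrInv.sigma_eq, RearrInv.sigma_eq]
          exact RearrInv.sigma_optTarget_le hn hl hkln ρ (RearrInv.monotone_rearrPrimitive g))
        (fun x => (f x).abs)
      rw [ENNReal.coe_inv hc0, mul_comm, ← div_eq_mul_inv,
        ENNReal.div_le_iff' (by exact_mod_cast hc0) ENNReal.coe_ne_top]
      exact h
    · exact RearrInv.assoc_anti (σ₁ := RearrInv.sigma (k + l) ρ)
        (σ₂ := RearrInv.sigma l (RearrInv.optTarget k ρ)) (μ := volume)
        (RearrInv.sigma_const_mul_le hn (k + l) _) (by norm_num)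
        (fun g _ => by
          rw [RearrInv.sigma_eq, RearrInv.sigma_eq]
          exact RearrInv.le_sigma_optTarget hn hl hkln ρ (RearrInv.monotone_rearrPrimitive g))
        (fun x => (f x).abs)
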